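/- Consider randomized adaptive algorithms that access an unknown finite simple undirected graph $G=(V,E)$ on a known non-empty vertex set $V$, $n=|V|$, only through three kinds of query: a vertex query returns a uniformly random vertex of $V$; a degree query on $v\in V$ returns the degree $d(v)$; a neighbor query $(v,i)$ returns the $i$-th neighbor of $v$ in an arbitrary but fixed order on the neighbors of $v$, or fails if $v$ has fewer than $i$ neighbors. Computation and internal randomness are free; the cost is the expected number of queries. There are an algorithm $\mathcal A$, which receives $V$ and a real number $\varepsilon>0$ but not the number of edges, and absolute constants $C,k$ such that for every finite graph $G=(V,E)$ with $n$ vertices and $m=|E|\ge 1$ (undirected) edges, every order on the neighbors of its vertices and every $\varepsilon>0$ the following holds. With probability at least $2/3$, $\mathcal A$ outputs a vertex (otherwise it reports failure), and, conditioned on a vertex being output, that vertex is distributed according to a probability distribution $P$ on $V$ that is pointwise $\varepsilon$-close to the degree distribution $\mathcal D_d(v)=d(v)/2m$, that is, $$|P(v)-\mathcal D_d(v)|\le \varepsilon\,\mathcal D_d(v)\qquad\text{for all } v\in V .$$ With $\varepsilon'=\min(\varepsilon,1)$ (so $\varepsilon'=\varepsilon$ whenever $\varepsilon\le 1$), the expected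 number of vertex, degree and neighbor queries made by $\mathcal A$ is at most $$C\,\frac{n}{\sqrt{\varepsilon' m}}\,\log^k\!\Big(\frac{n}{\varepsilon'}\Big),$$ i.e. $\tilde O(n/\sqrt{\varepsilon m})$ for $\varepsilon\le 1$. -/

import Mathlib

universe u v

open scoped ENNReal

noncomputable section

namespace QueryModel

/-- A randomized adaptive query algorithm on a vertex set `V` with outputs in `α`, as a decision
tree with no bound on the computation between queries. Drawing internal randomness is free; the
three other kinds of inner node are the vertex, degree and neighbor queries. The tree is the same
for all graphs on `V`: a graph influences the run only through the answers to the queries. -/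
inductive QueryAlg (V : Type u) (α : Type v) : Type (max u v)
  /-- Stop and output `a`. -/
  | output (a : α) : QueryAlg V α
  /-- Draw a uniform element of `{0, …, k}`. -/
  | random (k : ℕ) (next : Fin (k + 1) → QueryAlg V α) : QueryAlg V α
  /-- Ask for a uniformly random vertex. -/
  | vertexQuery (next : V → QueryAlg V α) : QueryAlg V α
  /-- Ask for the degree of `v`. -/
  | degreeQuery (v : V) (next : ℕ → QueryAlg V α) : QueryAlg V α
  /-- Ask for the neighbor of `v` that has number `i`; the answer `none` means failure. -/
  | neighborQuery (v : V) (i : ℕ) (next : Option V → QueryAlg V α) : QueryAlg V α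

/-- A fixed order on the neighbors of each vertex of `G`, numbered from `0` to `d(v) - 1`. -/
abbrev NeighborOrder {V : Type u} [Fintype V] (G : SimpleGraph V) [DecidableRel G.Adj] : Type u :=
  (v : V) → Fin (G.degree v) ≃ G.neighborSet v

/-- The answer to the neighbor query `(v, i)`: `none` if `v` has no neighbor with number `i`. -/
def neighborAnswer {V : Type u} [Fintype V] {G : SimpleGraph V} [DecidableRel G.Adj]
    (order : NeighborOrder G) (v : V) (i : ℕ) : Option V :=
  if h : i < G.degree v then some (order v ⟨i, h⟩ : V) else none

/-- Count one more query. -/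
def tick {α : Type v} (x : α × ℕ) : α × ℕ := (x.1, x.2 + 1)

/-- The joint law of the output and of the number of queries made when the algorithm is run on
the graph `G`. -/
def QueryAlg.run {V : Type u} {α : Type v} [Fintype V] [Nonempty V] {G : SimpleGraph V}
    [DecidableRel G.Adj] (order : NeighborOrder G) : QueryAlg V α → PMF (α × ℕ)
  | .output a => PMF.pure (a, 0)
  | .random k next => (PMF.uniformOfFintype (Fin (k + 1))).bind fun j => (next j).run order
  | .vertexQuery next =>
      ((PMF.uniformOfFintype V).bind fun w => (next w).run order).map tick
  | .degreeQuery w next => ((next (G.degree w)).run order).map tick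
  | .neighborQuery w i next => ((next (neighborAnswer order w i)).run order).map tick

/-- The law of the output. -/
def QueryAlg.outputLaw {V : Type u} {α : Type v} [Fintype V] [Nonempty V] {G : SimpleGraph V}
    [DecidableRel G.Adj] (A : QueryAlg V α) (order : NeighborOrder G) : PMF α :=
  (A.run order).map Prod.fst

/-- The expected number of queries. -/
def QueryAlg.expectedQueries {V : Type u} {α : Type v} [Fintype V] [Nonempty V]
    {G : SimpleGraph V} [DecidableRel G.Adj] (A : QueryAlg V α) (order : NeighborOrder G) :
    ℝ≥0∞ :=
  ∑' x : α × ℕ, A.run order x * (x.2 : ℝ≥0∞)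

/-- For an algorithm whose output is a vertex or `none` (failure): the probability that it
produces a vertex. -/
def QueryAlg.successProb {V : Type u} [Fintype V] [Nonempty V]
    {G : SimpleGraph V} [DecidableRel G.Adj] (A : QueryAlg V (Option V))
    (order : NeighborOrder G) : ℝ≥0∞ :=
  ∑ w : V, A.outputLaw order (some w)

/-- `P` is pointwise `ε`-close to `Q`. -/
def PointwiseClose {Ω : Type u} (ε : ℝ) (P Q : PMF Ω) : Prop :=
  ∀ x, |(P x).toReal - (Q x).toReal| ≤ ε * (Q x).toReal

/-- The degree distribution `v ↦ d(v) / 2m` of a graph with `m ≥ 1` edges. -/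
def degreeDist {V : Type u} [Fintype V] [DecidableEq V] (G : SimpleGraph V) [DecidableRel G.Adj]
    (hm : 1 ≤ G.edgeFinset.card) : PMF V :=
  PMF.ofFintype (fun w => (G.degree w : ℝ≥0∞) / (2 * (G.edgeFinset.card : ℝ≥0∞))) (by
    simp only [div_eq_mul_inv]
    rw [← Finset.sum_mul, ← Nat.cast_sum, G.sum_degrees_eq_twice_card_edges]
    push_cast
    refine ENNReal.mul_inv_cancel ?_ (ENNReal.mul_ne_top (by simp) (by simp))
    have : G.edgeFinset.card ≠ 0 := by omega
    simpa using this)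

end QueryModel

end

open QueryModel

/-! Fix a threshold `θ = k + 1` and call a vertex light if its degree is at most `θ`. One trial
`vertexTrial k` costs at most 4 queries. It outputs a light `w` with probability `d(w) / (2nθ)`, and
a heavy `w` with its number of light neighbors in place of `d(w)`. At most `2m/θ` vertices are
heavy, so if `2m ≤ δθ²`, a heavy vertex loses at most a fraction `δ` of its degree
(`mul_degree_le_lightDegree`). Such a threshold is good: the law of its trials is proportional to
the degree up to a factor in `[1 - δ, 1]`.

Since `m` is unknown, the thresholds descend from `2^J ≈ n/δ`, with `δ = min ε 1 / 8`, by halving;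
phase `i` makes `64 J 2^i` trials, and the first success is returned. The first phase is good. At
the last good phase `δθ² < 8m`, so the expected number of successes there is at least `4J`, and all
good phases fail together with probability at most `2^(-4J)` (`exists_trialSchedule_eq_append`).

Up to that point there are `O(J n / √(mδ))` trials. The remaining ones number at most `128 J 2^J`
and are reached so rarely that they affect neither the cost (`expectedQueries_trialSchedule_le`) nor
the law (`outProb_trialSchedule_close`). No estimate of `m` is needed. -/

namespace QueryModel

/-! ### Expectations under a `PMF`. -/

section Expectation

variable {α β : Type*}

/-- The expectation of `g` under `p`. -/
noncomputable def expect (p : PMF α) (g : α → ℝ≥0∞) : ℝ≥0∞ := ∑' a, p a * g a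

theorem expect_pure (a : α) (g : α → ℝ≥0∞) : expect (PMF.pure a) g = g a := by
  classical
  rw [expect, tsum_eq_single a]
  · simp
  · intro b hb
    simp [PMF.pure_apply, hb]

theorem expect_bind (p : PMF α) (f : α → PMF β) (g : β → ℝ≥0∞) :
    expect (p.bind f) g = expect p fun a => expect (f a) g := by
  simp only [expect, PMF.bind_apply, ← ENNReal.tsum_mul_right, ← ENNReal.tsum_mul_left]
  rw [ENNReal.tsum_comm]
  simp only [mul_assoc]

theorem expect_map (p : PMF α) (f : α → β) (g : β → ℝ≥0∞) :
    expect (p.map f) g = expect p fun a => g (f a) := by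
  rw [← PMF.bind_pure_comp, expect_bind]
  simp [expect_pure]

theorem expect_const (p : PMF α) (c : ℝ≥0∞) : expect p (fun _ => c) = c := by
  rw [expect, ENNReal.tsum_mul_right, p.tsum_coe, one_mul]

theorem expect_add (p : PMF α) (g h : α → ℝ≥0∞) :
    expect p (fun a => g a + h a) = expect p g + expect p h := by
  simp only [expect, mul_add, ENNReal.tsum_add]

theorem expect_mono (p : PMF α) {g h : α → ℝ≥0∞} (H : ∀ a, g a ≤ h a) :
    expect p g ≤ expect p h :=
  ENNReal.tsum_le_tsum fun a => by gcongr; exact H a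

theorem expect_le_of_forall_le (p : PMF α) {g : α → ℝ≥0∞} {c : ℝ≥0∞} (H : ∀ a, g a ≤ c) :
    expect p g ≤ c :=
  (expect_mono p H).trans_eq (expect_const p c)

end Expectation

/-! ### Sequential composition: output law and expected cost. -/

namespace QueryAlg

variable {V : Type u} {α β : Type v}

/-- Run `A`, then continue with the algorithm that `f` assigns to its output. -/
def bind (A : QueryAlg V α) (f : α → QueryAlg V β) : QueryAlg V β :=
  match A with
  | .output a => f a
  | .random k next => .random k fun j => (next j).bind f
  | .vertexQuery next => .vertexQuery fun w => (next w).bind f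
  | .degreeQuery w next => .degreeQuery w fun d => (next d).bind f
  | .neighborQuery w i next => .neighborQuery w i fun o => (next o).bind f

variable [Fintype V] [Nonempty V] {G : SimpleGraph V} [DecidableRel G.Adj] (order : NeighborOrder G)

theorem expectedQueries_eq_expect (A : QueryAlg V α) :
    A.expectedQueries order = expect (A.run order) fun x => (x.2 : ℝ≥0∞) := rfl

theorem expect_map_tick (p : PMF (α × ℕ)) :
    expect (p.map tick) (fun x => (x.2 : ℝ≥0∞)) = 1 + expect p fun x => (x.2 : ℝ≥0∞) := by
  simp only [expect_map, tick, Nat.cast_add, Nat.cast_one, expect_add, expect_const, add_comm]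

theorem map_tick_fst (p : PMF (α × ℕ)) : (p.map tick).map Prod.fst = p.map Prod.fst := by
  rw [PMF.map_comp]; rfl

section Output

theorem outputLaw_output (a : α) :
    (output a : QueryAlg V α).outputLaw order = PMF.pure a := by
  simp [outputLaw, run, PMF.pure_map]

theorem outputLaw_random (k : ℕ) (next : Fin (k + 1) → QueryAlg V α) :
    (random k next).outputLaw order =
      (PMF.uniformOfFintype (Fin (k + 1))).bind fun j => (next j).outputLaw order := by
  simp only [outputLaw, run, PMF.map_bind]

theorem outputLaw_vertexQuery (next : V → QueryAlg V α) :
    (vertexQuery next).outputLaw order =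
      (PMF.uniformOfFintype V).bind fun w => (next w).outputLaw order := by
  simp only [outputLaw, run, map_tick_fst, PMF.map_bind]

theorem outputLaw_degreeQuery (w : V) (next : ℕ → QueryAlg V α) :
    (degreeQuery w next).outputLaw order = (next (G.degree w)).outputLaw order := by
  simp only [outputLaw, run, map_tick_fst]

theorem outputLaw_neighborQuery (w : V) (i : ℕ) (next : Option V → QueryAlg V α) :
    (neighborQuery w i next).outputLaw order =
      (next (neighborAnswer order w i)).outputLaw order := by
  simp only [outputLaw, run, map_tick_fst]

theorem outputLaw_bind (A : QueryAlg V α) (f : α → QueryAlg V β) :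
    (A.bind f).outputLaw order = (A.outputLaw order).bind fun a => (f a).outputLaw order := by
  induction A with
  | output a => simp [bind, outputLaw_output]
  | random k next ih => simp only [bind, outputLaw_random, PMF.bind_bind, ih]
  | vertexQuery next ih => simp only [bind, outputLaw_vertexQuery, PMF.bind_bind, ih]
  | degreeQuery w next ih => simp only [bind, outputLaw_degreeQuery, ih]
  | neighborQuery w i next ih => simp only [bind, outputLaw_neighborQuery, ih]

end Output

section Cost

theorem expectedQueries_output (a : α) :
    (output a : QueryAlg V α).expectedQueries order = 0 := by
  simp [expectedQueries_eq_expect, run, expect_pure]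

theorem expectedQueries_random (k : ℕ) (next : Fin (k + 1) → QueryAlg V α) :
    (random k next).expectedQueries order =
      expect (PMF.uniformOfFintype (Fin (k + 1))) fun j => (next j).expectedQueries order := by
  simp only [expectedQueries_eq_expect, run, expect_bind]

theorem expectedQueries_vertexQuery (next : V → QueryAlg V α) :
    (vertexQuery next).expectedQueries order =
      1 + expect (PMF.uniformOfFintype V) fun w => (next w).expectedQueries order := by
  simp only [expectedQueries_eq_expect, run, expect_map_tick, expect_bind]

theorem expectedQueries_degreeQuery (w : V) (next : ℕ → QueryAlg V α) :
    (degreeQuery w next).expectedQueries order =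
      1 + (next (G.degree w)).expectedQueries order := by
  simp only [expectedQueries_eq_expect, run, expect_map_tick]

theorem expectedQueries_neighborQuery (w : V) (i : ℕ) (next : Option V → QueryAlg V α) :
    (neighborQuery w i next).expectedQueries order =
      1 + (next (neighborAnswer order w i)).expectedQueries order := by
  simp only [expectedQueries_eq_expect, run, expect_map_tick]

theorem expectedQueries_bind (A : QueryAlg V α) (f : α → QueryAlg V β) :
    (A.bind f).expectedQueries order =
      A.expectedQueries order +
        expect (A.outputLaw order) fun a => (f a).expectedQueries order := by
  induction A with
  | output a => simp [bind, outputLaw_output, expectedQueries_output, expect_pure]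
  | random k next ih =>
    simp only [bind, outputLaw_random, expectedQueries_random, expect_bind, ih, expect_add]
  | vertexQuery next ih =>
    simp only [bind, outputLaw_vertexQuery, expectedQueries_vertexQuery, expect_bind, ih,
      expect_add, add_assoc]
  | degreeQuery w next ih =>
    simp only [bind, outputLaw_degreeQuery, expectedQueries_degreeQuery, ih, add_assoc]
  | neighborQuery w i next ih =>
    simp only [bind, outputLaw_neighborQuery, expectedQueries_neighborQuery, ih, add_assoc]

end Cost

end QueryAlg

/-! ### The first success in a list of algorithms. -/

section FirstSuccess

open QueryAlg

variable {V : Type u}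

/-- Run the algorithms of a list one after the other until one of them produces a vertex. -/
def firstSuccess : List (QueryAlg V (Option V)) → QueryAlg V (Option V)
  | [] => .output none
  | A :: l => A.bind fun
    | some w => .output (some w)
    | none => firstSuccess l

variable [Fintype V] [Nonempty V] {G : SimpleGraph V} [DecidableRel G.Adj] (order : NeighborOrder G)

/-- The probability that `A` outputs `o`, as a real number. -/
noncomputable def outProb (A : QueryAlg V (Option V)) (o : Option V) : ℝ :=
  (A.outputLaw order o).toReal

theorem outProb_nonneg (A : QueryAlg V (Option V)) (o : Option V) : 0 ≤ outProb order A o :=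
  ENNReal.toReal_nonneg

theorem outProb_le_one (A : QueryAlg V (Option V)) (o : Option V) : outProb order A o ≤ 1 :=
  ENNReal.toReal_le_of_le_ofReal zero_le_one (by simpa using PMF.coe_le_one _ o)

theorem outProb_none_add_sum (A : QueryAlg V (Option V)) :
    outProb order A none + ∑ w, outProb order A (some w) = 1 := by
  have h := (A.outputLaw order).tsum_coe
  rw [tsum_fintype, Fintype.sum_option] at h
  have h' := congrArg ENNReal.toReal h
  rwa [ENNReal.toReal_add (PMF.apply_ne_top _ _)
    (ENNReal.sum_ne_top.2 fun _ _ => PMF.apply_ne_top _ _),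
    ENNReal.toReal_sum fun _ _ => PMF.apply_ne_top _ _, ENNReal.toReal_one] at h'

theorem outProb_firstSuccess_nil_none :
    outProb order (firstSuccess ([] : List (QueryAlg V (Option V)))) none = 1 := by
  simp [outProb, firstSuccess, outputLaw_output]

theorem outProb_firstSuccess_nil_some (w : V) :
    outProb order (firstSuccess ([] : List (QueryAlg V (Option V)))) (some w) = 0 := by
  simp [outProb, firstSuccess, outputLaw_output]

theorem outProb_firstSuccess_cons_none (A : QueryAlg V (Option V))
    (l : List (QueryAlg V (Option V))) :
    outProb order (firstSuccess (A :: l)) none =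
      outProb order A none * outProb order (firstSuccess l) none := by
  classical
  simp only [outProb, firstSuccess, outputLaw_bind, PMF.bind_apply, tsum_fintype,
    Fintype.sum_option, outputLaw_output, PMF.pure_apply]
  simp

theorem outProb_firstSuccess_cons_some (A : QueryAlg V (Option V))
    (l : List (QueryAlg V (Option V))) (w : V) :
    outProb order (firstSuccess (A :: l)) (some w) =
      outProb order A (some w) +
        outProb order A none * outProb order (firstSuccess l) (some w) := by
  classical
  simp only [outProb, firstSuccess, outputLaw_bind, PMF.bind_apply, tsum_fintype,
    Fintype.sum_option, outputLaw_output, PMF.pure_apply]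
  simp only [Option.some.injEq, mul_ite, mul_one, mul_zero, Finset.sum_ite_eq, Finset.mem_univ,
    if_true]
  rw [ENNReal.toReal_add (ENNReal.mul_ne_top (PMF.apply_ne_top _ _) (PMF.apply_ne_top _ _))
    (PMF.apply_ne_top _ _), ENNReal.toReal_mul, add_comm]

theorem outProb_firstSuccess_append_none (l₁ l₂ : List (QueryAlg V (Option V))) :
    outProb order (firstSuccess (l₁ ++ l₂)) none =
      outProb order (firstSuccess l₁) none * outProb order (firstSuccess l₂) none := by
  induction l₁ with
  | nil => simp [outProb_firstSuccess_nil_none]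
  | cons A l ih => simp only [List.cons_append, outProb_firstSuccess_cons_none, ih, mul_assoc]

theorem outProb_firstSuccess_append_some (l₁ l₂ : List (QueryAlg V (Option V))) (w : V) :
    outProb order (firstSuccess (l₁ ++ l₂)) (some w) =
      outProb order (firstSuccess l₁) (some w) +
        outProb order (firstSuccess l₁) none * outProb order (firstSuccess l₂) (some w) := by
  induction l₁ with
  | nil => simp [outProb_firstSuccess_nil_none, outProb_firstSuccess_nil_some]
  | cons A l ih =>
    simp only [List.cons_append, outProb_firstSuccess_cons_none, outProb_firstSuccess_cons_some,
      ih]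
    ring

theorem outProb_firstSuccess_replicate_none (T : ℕ) (A : QueryAlg V (Option V)) :
    outProb order (firstSuccess (List.replicate T A)) none = outProb order A none ^ T := by
  induction T with
  | zero => simp [outProb_firstSuccess_nil_none]
  | succ T ih => rw [List.replicate_succ, outProb_firstSuccess_cons_none, ih, pow_succ']

theorem expectedQueries_firstSuccess_cons (A : QueryAlg V (Option V))
    (l : List (QueryAlg V (Option V))) :
    (firstSuccess (A :: l)).expectedQueries order =
      A.expectedQueries order +
        ENNReal.ofReal (outProb order A none) * (firstSuccess l).expectedQueries order := by
  simp only [firstSuccess, expectedQueries_bind, expect, tsum_fintype, Fintype.sum_option,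
    expectedQueries_output]
  simp [outProb, ENNReal.ofReal_toReal (PMF.apply_ne_top _ _)]

theorem expectedQueries_firstSuccess_le {c : ℝ≥0∞} (l : List (QueryAlg V (Option V)))
    (hl : ∀ A ∈ l, A.expectedQueries order ≤ c) :
    (firstSuccess l).expectedQueries order ≤ c * l.length := by
  induction l with
  | nil => simp [firstSuccess, expectedQueries_output]
  | cons A l ih =>
    rw [expectedQueries_firstSuccess_cons, List.length_cons, Nat.cast_add, Nat.cast_one, mul_add,
      mul_one, add_comm]
    refine add_le_add ?_ (hl A (by simp))
    refine (mul_le_of_le_one_left zero_le ?_).trans (ih fun B hB => hl B (by simp [hB]))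
    exact ENNReal.ofReal_le_one.2 (outProb_le_one order A none)

theorem expectedQueries_firstSuccess_append (l₁ l₂ : List (QueryAlg V (Option V))) :
    (firstSuccess (l₁ ++ l₂)).expectedQueries order =
      (firstSuccess l₁).expectedQueries order +
        ENNReal.ofReal (outProb order (firstSuccess l₁) none) *
          (firstSuccess l₂).expectedQueries order := by
  induction l₁ with
  | nil =>
    simp [outProb_firstSuccess_nil_none, show (firstSuccess []).expectedQueries order = 0 from
      expectedQueries_output order none]
  | cons A l ih =>
    simp only [List.cons_append, expectedQueries_firstSuccess_cons,
      outProb_firstSuccess_cons_none, ih]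
    rw [ENNReal.ofReal_mul (outProb_nonneg _ _ _)]
    ring

/-- If each algorithm of a list outputs `w` with probability `c * d w` up to a factor in
`[1 - δ, 1]`, then so does the first success, for some `c` that does not depend on `w`. -/
theorem exists_firstSuccess_proportional {d : V → ℝ} {δ : ℝ} (l : List (QueryAlg V (Option V)))
    (hl : ∀ A ∈ l, ∃ c : ℝ, ∀ w, (1 - δ) * (c * d w) ≤ outProb order A (some w) ∧
      outProb order A (some w) ≤ c * d w) :
    ∃ c : ℝ, ∀ w, (1 - δ) * (c * d w) ≤ outProb order (firstSuccess l) (some w) ∧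
      outProb order (firstSuccess l) (some w) ≤ c * d w := by
  induction l with
  | nil => exact ⟨0, fun w => by simp [outProb_firstSuccess_nil_some]⟩
  | cons A l ih =>
    obtain ⟨a, ha⟩ := hl A (by simp)
    obtain ⟨c, hc⟩ := ih fun B hB => hl B (by simp [hB])
    have h0 := outProb_nonneg order A none
    -- The tail is weighted by the failure probability of `A`, which does not depend on `w`, so
    -- proportionality survives.
    refine ⟨a + outProb order A none * c, fun w => ?_⟩
    rw [outProb_firstSuccess_cons_some]
    have h1 := mul_le_mul_of_nonneg_left (hc w).1 h0
    have h2 := mul_le_mul_of_nonneg_left (hc w).2 h0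
    constructor
    · linarith [(ha w).1]
    · linarith [(ha w).2]

theorem outProb_firstSuccess_eq_zero (l : List (QueryAlg V (Option V))) (w : V)
    (hl : ∀ A ∈ l, outProb order A (some w) = 0) :
    outProb order (firstSuccess l) (some w) = 0 := by
  induction l with
  | nil => exact outProb_firstSuccess_nil_some order w
  | cons A l ih =>
    rw [outProb_firstSuccess_cons_some, hl A (by simp), ih fun B hB => hl B (by simp [hB])]
    simp

end FirstSuccess

/-! ### Counting light and heavy neighbors. -/

section LightDegree

variable {V : Type u} [Fintype V] {G : SimpleGraph V} [DecidableRel G.Adj]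

theorem card_filter_fin_lt {k d : ℕ} (hd : d ≤ k + 1) :
    (Finset.univ.filter fun i : Fin (k + 1) => i.val < d).card = d := by
  rw [Fin.card_filter_val_lt, min_eq_right hd]

/-- For light `u` the numbers `0, …, k` cover all its neighbors, each exactly once. -/
theorem card_filter_neighborAnswer [DecidableEq V] (order : NeighborOrder G) (k : ℕ) {u : V}
    (hu : G.degree u ≤ k + 1) (w : V) :
    (Finset.univ.filter fun i : Fin (k + 1) => neighborAnswer order u i = some w).card =
      if G.Adj u w then 1 else 0 := by
  split_ifs with h
  · rw [Finset.card_eq_one]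
    set i := (order u).symm ⟨w, h⟩ with hi
    refine ⟨⟨i, i.2.trans_le hu⟩, ?_⟩
    ext j
    simp only [Finset.mem_filter, Finset.mem_univ, true_and, Finset.mem_singleton]
    rw [neighborAnswer]
    constructor
    · intro hj
      split_ifs at hj with hlt
      have : order u ⟨j, hlt⟩ = ⟨w, h⟩ := Subtype.ext (Option.some.inj hj)
      ext
      rw [hi, ← this, Equiv.symm_apply_apply]
    · rintro rfl
      rw [dif_pos i.2]
      simp [hi]
  · rw [Finset.card_eq_zero, Finset.filter_eq_empty_iff]
    intro i _ hi
    rw [neighborAnswer] at hi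
    split_ifs at hi with hlt
    have := (order u ⟨i, hlt⟩).2
    rw [Option.some.inj hi] at this
    exact h this

/-- The number of neighbors of `w` of degree at most `k + 1`. -/
def lightDegree (G : SimpleGraph V) [DecidableRel G.Adj] (k : ℕ) (w : V) : ℕ :=
  (Finset.univ.filter fun u => G.degree u ≤ k + 1 ∧ G.Adj u w).card

theorem lightDegree_le_degree (k : ℕ) (w : V) : lightDegree G k w ≤ G.degree w := by
  classical
  rw [← G.card_neighborFinset_eq_degree, lightDegree]
  refine Finset.card_le_card fun u hu => ?_
  rw [SimpleGraph.mem_neighborFinset]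
  exact (Finset.mem_filter.1 hu).2.2.symm

theorem degree_le_lightDegree_add (k : ℕ) (w : V) :
    G.degree w ≤ lightDegree G k w + (Finset.univ.filter fun u => ¬ G.degree u ≤ k + 1).card := by
  classical
  rw [← G.card_neighborFinset_eq_degree, lightDegree]
  refine le_trans (Finset.card_le_card fun u hu => ?_) (Finset.card_union_le _ _)
  rw [SimpleGraph.mem_neighborFinset] at hu
  by_cases h : G.degree u ≤ k + 1 <;> simp [h, hu.symm, not_le.1]

/-- Markov's inequality for the degree sum. -/
theorem card_heavy_mul_le (k : ℕ) :
    (Finset.univ.filter fun u => ¬ G.degree u ≤ k + 1).card * (k + 1) ≤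
      2 * G.edgeFinset.card := by
  rw [← G.sum_degrees_eq_twice_card_edges, ← smul_eq_mul]
  refine (Finset.card_nsmul_le_sum _ (fun u => G.degree u) _ fun u hu => ?_).trans
    (Finset.sum_le_sum_of_subset (Finset.subset_univ _))
  have := (Finset.mem_filter.1 hu).2
  omega

/-- There are at most `2m / (k + 1) ≤ δ (k + 1)` heavy vertices, and a heavy `w` has degree above `k
+ 1`; hence at most `δ d(w)` of its neighbors are heavy. -/
theorem mul_degree_le_lightDegree {k : ℕ} {δ : ℝ}
    (hδ : 2 * (G.edgeFinset.card : ℝ) ≤ δ * ((k : ℝ) + 1) ^ 2) {w : V}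
    (hw : ¬ G.degree w ≤ k + 1) :
    (1 - δ) * (G.degree w : ℝ) ≤ lightDegree G k w := by
  have hk : (0 : ℝ) < k + 1 := by positivity
  set H := (Finset.univ.filter fun u => ¬ G.degree u ≤ k + 1).card with hH
  have h1 : (H : ℝ) * (k + 1) ≤ 2 * G.edgeFinset.card := by exact_mod_cast card_heavy_mul_le k
  have h2 : (G.degree w : ℝ) ≤ lightDegree G k w + H := by
    exact_mod_cast degree_le_lightDegree_add k w
  have h3 : (H : ℝ) ≤ δ * (k + 1) := by
    refine le_of_mul_le_mul_right ?_ hk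
    linarith
  have h4 : ((k : ℝ) + 1) ≤ G.degree w := by exact_mod_cast (not_le.1 hw).le
  have hδ0 : 0 ≤ δ := by
    by_contra! h
    nlinarith [Nat.cast_nonneg (α := ℝ) H]
  nlinarith [mul_le_mul_of_nonneg_left h4 hδ0]

end LightDegree

/-! ### A single trial: cost and output law. -/

section VertexTrial

open QueryAlg

variable {V : Type u}

/-- One attempt of producing a vertex. A vertex is light if its degree is at most `k + 1`, and
heavy otherwise. A uniformly random vertex `u` is rejected if it is heavy. Otherwise, for a uniform
`i ≤ k`, either `u` is output if it has a neighbor with number `i`, or that neighbor is output if it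
exists and is heavy. -/
def vertexTrial (k : ℕ) : QueryAlg V (Option V) :=
  .vertexQuery fun u => .degreeQuery u fun d =>
    if d ≤ k + 1 then
      .random 1 fun b => .random k fun i =>
        if b = 0 then .output (if i.val < d then some u else none)
        else .neighborQuery u i fun o => o.elim (.output none) fun w =>
          .degreeQuery w fun e => .output (if e ≤ k + 1 then none else some w)
    else .output none

variable [Fintype V] [Nonempty V] {G : SimpleGraph V} [DecidableRel G.Adj] (order : NeighborOrder G)

theorem expectedQueries_vertexTrial_le (k : ℕ) :
    (vertexTrial k : QueryAlg V (Option V)).expectedQueries order ≤ 4 := by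
  rw [vertexTrial, expectedQueries_vertexQuery]
  have key : ∀ u : V, (QueryAlg.degreeQuery u fun d =>
    if d ≤ k + 1 then
      QueryAlg.random 1 fun b => .random k fun i =>
        if b = 0 then .output (if i.val < d then some u else none)
        else .neighborQuery u i fun o => o.elim (.output none) fun w =>
          .degreeQuery w fun e => .output (if e ≤ k + 1 then none else some w)
    else .output none).expectedQueries order ≤ 3 := by
    intro u
    rw [expectedQueries_degreeQuery]
    have h3 : (3 : ℝ≥0∞) = 1 + 2 := by norm_num
    rw [h3]
    gcongr
    split_ifs with h
    · rw [expectedQueries_random]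
      refine expect_le_of_forall_le _ fun b => ?_
      rw [expectedQueries_random]
      refine expect_le_of_forall_le _ fun i => ?_
      split_ifs
      · simp [expectedQueries_output]
      · simp [expectedQueries_output]
      · rw [expectedQueries_neighborQuery]
        cases neighborAnswer order u i with
        | none => simp [expectedQueries_output]
        | some w =>
          simp [expectedQueries_degreeQuery, expectedQueries_output, one_add_one_eq_two]
    · simp [expectedQueries_output]
  calc _ ≤ (1 : ℝ≥0∞) + 3 := by
        gcongr
        exact expect_le_of_forall_le _ key
    _ = 4 := by norm_num

/-- Within each branch of the coin, every pair `(u, i)` with `u` light has weight `1 / (2n(k + 1))`.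
The pairs that lead to `w` are counted: for light `w` they are `(w, i)` with `i < d(w)`; for heavy
`w` there is one for each light neighbor. -/
theorem outputLaw_vertexTrial_some (k : ℕ) (w : V) :
    (vertexTrial k).outputLaw order (some w) =
      (Fintype.card V : ℝ≥0∞)⁻¹ * (2⁻¹ * (((k + 1 : ℕ) : ℝ≥0∞)⁻¹ *
        ((if G.degree w ≤ k + 1 then G.degree w else lightDegree G k w : ℕ) : ℝ≥0∞))) := by
  classical
  have h0 : ∀ (u : V) (i : Fin (k + 1)),
      (QueryAlg.output (if i.val < G.degree u then some u else none)).outputLaw order (some w) =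
        if i.val < G.degree u ∧ u = w then 1 else 0 := by
    intro u i
    rw [outputLaw_output, PMF.pure_apply]
    by_cases h : i.val < G.degree u <;> simp [h, eq_comm]
  have h1 : ∀ (u : V) (i : Fin (k + 1)),
      (QueryAlg.neighborQuery u i fun o => o.elim (.output none) fun w =>
          .degreeQuery w fun e => .output (if e ≤ k + 1 then none else some w)).outputLaw order
            (some w) =
        if neighborAnswer order u i = some w ∧ ¬ G.degree w ≤ k + 1 then 1 else 0 := by
    intro u i
    rw [outputLaw_neighborQuery]
    cases neighborAnswer order u i with
    | none => simp [outputLaw_output]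
    | some x =>
      rw [Option.elim_some, outputLaw_degreeQuery, outputLaw_output, PMF.pure_apply]
      by_cases hx : x = w
      · subst hx
        by_cases h : G.degree x ≤ k + 1 <;> simp [h]
      · by_cases h : G.degree x ≤ k + 1 <;> simp [h, hx, Ne.symm hx]
  have h2 : ∀ u : V, G.degree u ≤ k + 1 →
      (∑ i : Fin (k + 1), (if i.val < G.degree u ∧ u = w then 1 else 0 : ℝ≥0∞)) +
        (∑ i : Fin (k + 1),
          (if neighborAnswer order u i = some w ∧ ¬ G.degree w ≤ k + 1 then 1 else 0 : ℝ≥0∞)) =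
      ((if u = w then G.degree w else 0) +
        (if G.Adj u w ∧ ¬ G.degree w ≤ k + 1 then 1 else 0) : ℕ) := by
    intro u hu
    rw [Finset.sum_boole, Finset.sum_boole, ← Nat.cast_add]
    congr 2
    · by_cases h : u = w
      · subst h
        simp [card_filter_fin_lt hu]
      · simp [h]
    · by_cases h : G.degree w ≤ k + 1
      · simp [h]
      · simpa [h] using card_filter_neighborAnswer order k hu w
  have h3 : ∀ u : V, (QueryAlg.degreeQuery u fun d =>
      if d ≤ k + 1 then
        QueryAlg.random 1 fun b => .random k fun i =>
          if b = 0 then .output (if i.val < d then some u else none)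
          else .neighborQuery u i fun o => o.elim (.output none) fun w =>
            .degreeQuery w fun e => .output (if e ≤ k + 1 then none else some w)
      else .output none).outputLaw order (some w) =
      2⁻¹ * (((k + 1 : ℕ) : ℝ≥0∞)⁻¹ * ((if G.degree u ≤ k + 1 then
        (if u = w then G.degree w else 0) +
        (if G.Adj u w ∧ ¬ G.degree w ≤ k + 1 then 1 else 0) else 0 : ℕ) : ℝ≥0∞)) := by
    intro u
    rw [outputLaw_degreeQuery]
    by_cases hu : G.degree u ≤ k + 1
    · rw [if_pos hu, if_pos hu, ← h2 u hu]
      rw [outputLaw_random, PMF.bind_apply, tsum_fintype, Fin.sum_univ_two]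
      simp only [outputLaw_random, PMF.bind_apply, tsum_fintype, PMF.uniformOfFintype_apply,
        Fintype.card_fin, ← Finset.mul_sum, if_true, one_ne_zero, if_false, h0, h1]
      rw [← mul_add, ← mul_add]
      norm_num
    · rw [if_neg hu, if_neg hu, outputLaw_output]
      simp
  rw [vertexTrial, outputLaw_vertexQuery, PMF.bind_apply, tsum_fintype]
  simp only [PMF.uniformOfFintype_apply, h3, ← Finset.mul_sum, ← Nat.cast_sum]
  congr 5
  by_cases hw : G.degree w ≤ k + 1
  · rw [if_pos hw, Finset.sum_eq_single w]
    · simp [hw]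
    · intro u _ hu
      simp [hu, hw]
    · simp
  · rw [if_neg hw, lightDegree, Finset.card_filter]
    refine Finset.sum_congr rfl fun u _ => ?_
    by_cases hu : G.degree u ≤ k + 1
    · have : u ≠ w := by rintro rfl; exact hw hu
      simp [hu, hw, this]
    · simp [hu]

theorem outProb_vertexTrial_some (k : ℕ) (w : V) :
    outProb order (vertexTrial k) (some w) = (2 * (Fintype.card V : ℝ) * ((k : ℝ) + 1))⁻¹ *
      ((if G.degree w ≤ k + 1 then G.degree w else lightDegree G k w : ℕ) : ℝ) := by
  rw [outProb, outputLaw_vertexTrial_some]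
  simp only [ENNReal.toReal_mul, ENNReal.toReal_inv, ENNReal.toReal_natCast, ENNReal.toReal_ofNat]
  rw [Nat.cast_add, Nat.cast_one, mul_inv, mul_inv]
  ring

theorem outProb_vertexTrial_le (k : ℕ) (w : V) :
    outProb order (vertexTrial k) (some w) ≤
      (2 * Fintype.card V * ((k : ℝ) + 1))⁻¹ * G.degree w := by
  rw [outProb_vertexTrial_some]
  gcongr
  split_ifs
  · exact le_rfl
  · exact lightDegree_le_degree k w

theorem le_outProb_vertexTrial {k : ℕ} {δ : ℝ}
    (hδ : 2 * (G.edgeFinset.card : ℝ) ≤ δ * ((k : ℝ) + 1) ^ 2) (w : V) :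
    (1 - δ) * ((2 * Fintype.card V * ((k : ℝ) + 1))⁻¹ * G.degree w) ≤
      outProb order (vertexTrial k) (some w) := by
  rw [outProb_vertexTrial_some, mul_left_comm]
  gcongr
  split_ifs with h
  -- A light vertex has no loss; only `δ ≥ 0` is needed, which `hδ` forces.
  · have hδ0 : 0 ≤ δ := by
      by_contra! h
      nlinarith [Nat.cast_nonneg (α := ℝ) G.edgeFinset.card, sq_nonneg ((k : ℝ) + 1),
        mul_pos_of_neg_of_neg h (neg_lt_zero.2 (show (0 : ℝ) < (k + 1) ^ 2 by positivity))]
    nlinarith [Nat.cast_nonneg (α := ℝ) (G.degree w)]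
  · exact mul_degree_le_lightDegree hδ h

end VertexTrial

/-! ### Lists with geometrically growing repetition. -/

section Schedule

variable {α : Type*}

/-- The list with `M * 2 ^ i` copies of `B i`, for `i = 0, …, K - 1` in this order. -/
def geometricSchedule (M K : ℕ) (B : ℕ → α) : List α :=
  (List.range K).flatMap fun i => List.replicate (M * 2 ^ i) (B i)

theorem geometricSchedule_succ (M K : ℕ) (B : ℕ → α) :
    geometricSchedule M (K + 1) B =
      geometricSchedule M K B ++ List.replicate (M * 2 ^ K) (B K) := by
  simp [geometricSchedule, List.range_succ]

theorem length_geometricSchedule_le (M K : ℕ) (B : ℕ → α) :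
    (geometricSchedule M K B).length ≤ M * 2 ^ K := by
  induction K with
  | zero => simp [geometricSchedule]
  | succ K ih =>
    rw [geometricSchedule_succ, List.length_append, List.length_replicate, pow_succ]
    linarith

theorem exists_of_mem_geometricSchedule {M K : ℕ} {B : ℕ → α} {x : α}
    (hx : x ∈ geometricSchedule M K B) : ∃ i < K, x = B i := by
  obtain ⟨i, hi, hx⟩ := List.mem_flatMap.1 hx
  exact ⟨i, List.mem_range.1 hi, List.eq_of_mem_replicate hx⟩

theorem exists_geometricSchedule_eq_append (M : ℕ) {a K : ℕ} (h : a ≤ K) (B : ℕ → α) :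
    ∃ l, geometricSchedule M K B = geometricSchedule M a B ++ l := by
  obtain ⟨b, rfl⟩ := Nat.exists_eq_add_of_le h
  exact ⟨_, by rw [geometricSchedule, List.range_add, List.flatMap_append]; rfl⟩

end Schedule

/-! ### Analysis of the descending thresholds. -/

section Sampler

open QueryAlg

variable {V : Type u}

/-- Trials with the degree thresholds `2 ^ J, 2 ^ (J - 1), …, 1`, in this order; their number
doubles whenever the threshold is halved. -/
def trialSchedule (V : Type u) (J : ℕ) : List (QueryAlg V (Option V)) :=
  geometricSchedule (64 * J) (J + 1) fun i => vertexTrial (2 ^ (J - i) - 1)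

theorem exists_of_mem_trialSchedule {J : ℕ} {A : QueryAlg V (Option V)}
    (hA : A ∈ trialSchedule V J) : ∃ k, A = vertexTrial k :=
  let ⟨_, _, h⟩ := exists_of_mem_geometricSchedule hA
  ⟨_, h⟩

theorem exp_neg_four_mul_le (J : ℕ) : Real.exp (-(4 * J)) ≤ (((2 : ℝ) ^ J) ^ 4)⁻¹ := by
  rw [Real.exp_neg]
  gcongr
  rw [← pow_mul, mul_comm J 4]
  calc (2 : ℝ) ^ (4 * J) ≤ Real.exp 1 ^ (4 * J) := by
        gcongr
        linarith [Real.add_one_le_exp (1 : ℝ)]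
    _ = Real.exp (4 * J) := by
        rw [← Real.exp_nat_mul]
        push_cast
        ring_nf

variable [Fintype V] {G : SimpleGraph V} [DecidableRel G.Adj]

theorem sum_degree_real : ∑ w, (G.degree w : ℝ) = 2 * G.edgeFinset.card := by
  exact_mod_cast G.sum_degrees_eq_twice_card_edges

theorem two_mul_card_edgeFinset_le_sq :
    2 * (G.edgeFinset.card : ℝ) ≤ (Fintype.card V : ℝ) ^ 2 := by
  rw [← sum_degree_real, sq, ← nsmul_eq_mul, ← Finset.card_univ]
  refine Finset.sum_le_card_nsmul _ _ _ fun w _ => ?_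
  exact_mod_cast (G.degree_lt_card_verts w).le

variable [Nonempty V] (order : NeighborOrder G)

theorem outProb_vertexTrial_none_le {k : ℕ} {δ : ℝ}
    (hδ : 2 * (G.edgeFinset.card : ℝ) ≤ δ * ((k : ℝ) + 1) ^ 2) :
    outProb order (vertexTrial k) none ≤
      1 - (1 - δ) * (G.edgeFinset.card / (Fintype.card V * ((k : ℝ) + 1))) := by
  have h := outProb_none_add_sum order (vertexTrial k)
  have h1 := Finset.sum_le_sum fun w (_ : w ∈ Finset.univ) => le_outProb_vertexTrial order hδ w
  rw [← Finset.mul_sum, ← Finset.mul_sum, sum_degree_real] at h1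
  have h2 : (2 * (Fintype.card V : ℝ) * ((k : ℝ) + 1))⁻¹ * (2 * G.edgeFinset.card) =
      G.edgeFinset.card / (Fintype.card V * ((k : ℝ) + 1)) := by
    have : (Fintype.card V : ℝ) ≠ 0 := Nat.cast_ne_zero.2 Fintype.card_ne_zero
    field_simp
  rw [h2] at h1
  linarith

/-- The trials whose threshold is so large that their law is nearly proportional to the degree
succeed with high probability, and their number is of the right order. -/
theorem exists_trialSchedule_eq_append {J : ℕ} {δ : ℝ} (hδ : 0 < δ) (hδ' : δ ≤ 1 / 8)
    (hm : 1 ≤ G.edgeFinset.card) (hJ : (Fintype.card V : ℝ) ≤ δ * 2 ^ J)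
    (hJ' : δ * 2 ^ J ≤ 2 * Fintype.card V) :
    ∃ l₁ l₂ : List (QueryAlg V (Option V)), trialSchedule V J = l₁ ++ l₂ ∧
      (∀ A ∈ l₁, ∃ c : ℝ, ∀ w, (1 - δ) * (c * G.degree w) ≤ outProb order A (some w) ∧
        outProb order A (some w) ≤ c * G.degree w) ∧
      outProb order (firstSuccess l₁) none ≤ (((2 : ℝ) ^ J) ^ 4)⁻¹ ∧
      (l₁.length : ℝ) ≤
        64 * J * (4 * (Fintype.card V / Real.sqrt (2 * G.edgeFinset.card * δ))) := by
  set n : ℝ := (Fintype.card V : ℝ) with hn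
  set m : ℝ := (G.edgeFinset.card : ℝ) with hm'
  have hm1 : 1 ≤ m := Nat.one_le_cast.2 hm
  have hmn : 2 * m ≤ n ^ 2 := two_mul_card_edgeFinset_le_sq
  have hn0 : 0 < n := Nat.cast_pos.2 Fintype.card_pos
  -- At `i = J` the threshold is 1, which is bad because `δ < 2m`. Below, `b` is the first bad phase
  -- and `a = b - 1` the last good one.
  have hex : ∃ i, δ * ((2 : ℝ) ^ (J - i)) ^ 2 < 2 * m := ⟨J, by simp; linarith⟩
  classical
  obtain ⟨b, hb, hmin⟩ : ∃ b, δ * ((2 : ℝ) ^ (J - b)) ^ 2 < 2 * m ∧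
      ∀ i < b, 2 * m ≤ δ * ((2 : ℝ) ^ (J - i)) ^ 2 :=
    ⟨Nat.find hex, Nat.find_spec hex, fun i hi => not_lt.1 (Nat.find_min hex hi)⟩
  have hbJ : b ≤ J := by
    by_contra! h
    have := hmin J h
    simp at this
    linarith
  -- Phase 0 is good: `δ 4^J ≥ (δ 2^J)² ≥ n² ≥ 2m`.
  obtain ⟨a, rfl⟩ : ∃ a, b = a + 1 := by
    refine Nat.exists_eq_succ_of_ne_zero ?_
    rintro rfl
    rw [Nat.sub_zero] at hb
    have : n ^ 2 ≤ (δ * 2 ^ J) ^ 2 := by gcongr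
    have h2 : (δ * 2 ^ J) ^ 2 ≤ δ * ((2 : ℝ) ^ J) ^ 2 := by
      rw [mul_pow]
      gcongr
      nlinarith
    linarith
  set θ : ℝ := 2 ^ (J - a) with hθ
  have hθ0 : 0 < θ := by positivity
  have hθ2 : θ = 2 * 2 ^ (J - (a + 1)) := by
    rw [hθ, ← pow_succ']
    congr 1
    omega
  have hX : (2 : ℝ) ^ J = θ * 2 ^ a := by
    rw [hθ, ← pow_add]
    congr 1
    omega
  have hgood : 2 * m ≤ δ * θ ^ 2 := hmin a (Nat.lt_succ_self a)
  -- The next threshold `θ / 2` is bad.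
  have hbad : δ * θ ^ 2 < 8 * m := by
    rw [hθ2]
    linarith
  have hcast : ∀ i, (((2 ^ (J - i) - 1 : ℕ) : ℝ) + 1) = 2 ^ (J - i) := by
    intro i
    rw [Nat.cast_sub Nat.one_le_two_pow]
    push_cast
    ring
  obtain ⟨l₂, hl₂⟩ := exists_geometricSchedule_eq_append (64 * J) (show a + 1 ≤ J + 1 by omega)
    fun i => (vertexTrial (2 ^ (J - i) - 1) : QueryAlg V (Option V))
  refine ⟨_, l₂, hl₂, ?_, ?_, ?_⟩
  · intro A hA
    obtain ⟨i, hi, rfl⟩ := exists_of_mem_geometricSchedule hA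
    refine ⟨_, fun w => ⟨le_outProb_vertexTrial order ?_ w, outProb_vertexTrial_le order _ w⟩⟩
    rw [hcast]
    exact hmin i hi
  · rw [geometricSchedule_succ, outProb_firstSuccess_append_none,
      outProb_firstSuccess_replicate_none]
    -- The last good phase alone suffices for the failure bound.
    refine (mul_le_of_le_one_left (pow_nonneg (outProb_nonneg _ _ _) _)
      (outProb_le_one _ _ _)).trans ?_
    refine le_trans ?_ (exp_neg_four_mul_le J)
    have h1 := outProb_vertexTrial_none_le order (k := 2 ^ (J - a) - 1) (δ := δ)
      (by rw [hcast]; exact hgood)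
    rw [hcast, ← hn, ← hm', ← hθ] at h1
    have h2 := h1.trans (Real.one_sub_le_exp_neg _)
    refine (pow_le_pow_left₀ (outProb_nonneg _ _ _) h2 _).trans ?_
    rw [← Real.exp_nat_mul, Real.exp_le_exp, mul_neg, neg_le_neg_iff]
    push_cast
    have h3 : n ≤ δ * θ * 2 ^ a := by rw [mul_assoc, ← hX]; exact hJ
    -- By `h3`, `2^a ≥ n / (δθ)`, so the product is at least `m / (δθ²) > 1/8`. With `64 J` and `1 -
    -- δ ≥ 7/8` the exponent is at least `7J`, more than the `4J` required.
    have h4 : (1 / 8 : ℝ) ≤ 2 ^ a * (m / (n * θ)) := by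
      rw [← mul_div_assoc, le_div_iff₀ (by positivity)]
      have := mul_le_mul_of_nonneg_right h3 hθ0.le
      have h5 : δ * θ ^ 2 * 2 ^ a ≤ 8 * m * 2 ^ a := by gcongr
      nlinarith
    have h6 : (4 : ℝ) * J ≤ 64 * J * ((7 / 8) * (1 / 8)) := by
      nlinarith [Nat.cast_nonneg (α := ℝ) J]
    refine h6.trans ?_
    have h7 : (7 / 8 : ℝ) * (1 / 8) ≤ (1 - δ) * (2 ^ a * (m / (n * θ))) := by
      gcongr
      · linarith
      · linarith
    calc (64 : ℝ) * J * (7 / 8 * (1 / 8)) ≤ 64 * J * ((1 - δ) * (2 ^ a * (m / (n * θ)))) := by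
          gcongr
      _ = _ := by ring
  · have h1 : ((geometricSchedule (64 * J) (a + 1) fun i =>
        (vertexTrial (2 ^ (J - i) - 1) : QueryAlg V (Option V))).length : ℝ) ≤
          64 * J * 2 ^ (a + 1) := by
      exact_mod_cast length_geometricSchedule_le _ _ _
    refine h1.trans ?_
    gcongr
    -- Goodness of `θ`, multiplied by `δ`; then `2^a δθ = δ 2^J ≤ 2n` bounds the number of trials.
    have h2 : Real.sqrt (2 * m * δ) ≤ δ * θ := Real.sqrt_le_iff.2 ⟨by positivity, by nlinarith⟩
    rw [← mul_div_assoc, le_div_iff₀ (Real.sqrt_pos.2 (by positivity)), pow_succ]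
    calc (2 : ℝ) ^ a * 2 * Real.sqrt (2 * m * δ) ≤ 2 ^ a * 2 * (δ * θ) := by gcongr
      _ = 2 * (δ * 2 ^ J) := by rw [hX]; ring
      _ ≤ 4 * n := by linarith

/-- The algorithm: the thresholds of the trials start at about `8 * n / min ε 1`. -/
noncomputable def degreeSampler (V : Type u) [Fintype V] (ε : ℝ) : QueryAlg V (Option V) :=
  firstSuccess (trialSchedule V (Nat.clog 2 ⌈(Fintype.card V : ℝ) / (min ε 1 / 8)⌉₊))

theorem expectedQueries_trialSchedule_le {J : ℕ} {δ : ℝ} (hδ : 0 < δ) (hδ' : δ ≤ 1 / 8)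
    (hm : 1 ≤ G.edgeFinset.card) {l₁ l₂ : List (QueryAlg V (Option V))}
    (hl : trialSchedule V J = l₁ ++ l₂)
    (hF : outProb order (firstSuccess l₁) none ≤ (((2 : ℝ) ^ J) ^ 4)⁻¹)
    (hlen : (l₁.length : ℝ) ≤
      64 * J * (4 * (Fintype.card V / Real.sqrt (2 * G.edgeFinset.card * δ)))) :
    (firstSuccess (trialSchedule V J)).expectedQueries order ≤
      ENNReal.ofReal (2048 * J * (Fintype.card V / Real.sqrt (2 * G.edgeFinset.card * δ))) := by
  set n : ℝ := (Fintype.card V : ℝ) with hn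
  set m : ℝ := (G.edgeFinset.card : ℝ) with hm'
  have hm1 : 1 ≤ m := Nat.one_le_cast.2 hm
  have hmn : 2 * m ≤ n ^ 2 := two_mul_card_edgeFinset_le_sq
  have hn0 : 0 < n := Nat.cast_pos.2 Fintype.card_pos
  have hs : 0 < Real.sqrt (2 * m * δ) := Real.sqrt_pos.2 (by positivity)
  -- This lets the main term absorb the additive `O(J)` cost of the trials after `l₁`.
  have hR : 1 ≤ n / Real.sqrt (2 * m * δ) := by
    rw [one_le_div hs]
    exact Real.sqrt_le_iff.2 ⟨hn0.le, by nlinarith⟩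
  have h4 : ∀ A ∈ trialSchedule V J, A.expectedQueries order ≤ 4 := by
    intro A hA
    obtain ⟨k, rfl⟩ := exists_of_mem_trialSchedule hA
    exact expectedQueries_vertexTrial_le order k
  rw [hl] at h4 ⊢
  have hlen₂ : (l₂.length : ℝ) ≤ 128 * J * 2 ^ J := by
    have h1 := length_geometricSchedule_le (64 * J) (J + 1)
      fun i => (vertexTrial (2 ^ (J - i) - 1) : QueryAlg V (Option V))
    have h2 := congrArg List.length hl
    rw [List.length_append] at h2
    have h3 : l₂.length ≤ 64 * J * 2 ^ (J + 1) :=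
      (Nat.le_add_left _ _).trans (h2.symm.le.trans h1)
    have h3' : (l₂.length : ℝ) ≤ 64 * J * 2 ^ (J + 1) := by exact_mod_cast h3
    rw [pow_succ] at h3'
    linarith
  have hFl : outProb order (firstSuccess l₁) none * l₂.length ≤ 128 * J := by
    have hX : (1 : ℝ) ≤ 2 ^ J := one_le_pow₀ one_le_two
    calc _ ≤ (((2 : ℝ) ^ J) ^ 4)⁻¹ * (128 * J * 2 ^ J) := by gcongr
      _ ≤ ((2 : ℝ) ^ J)⁻¹ * (128 * J * 2 ^ J) := by
          gcongr
          exact le_self_pow₀ hX (by norm_num)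
      _ = 128 * J := by field_simp
  have e : ∀ l : List (QueryAlg V (Option V)),
      (4 : ℝ≥0∞) * l.length = ENNReal.ofReal (4 * l.length) := by
    intro l
    rw [ENNReal.ofReal_mul (by norm_num)]
    simp
  rw [expectedQueries_firstSuccess_append]
  calc _ ≤ 4 * (l₁.length : ℝ≥0∞) +
        ENNReal.ofReal (outProb order (firstSuccess l₁) none) * (4 * (l₂.length : ℝ≥0∞)) := by
        gcongr
        · exact expectedQueries_firstSuccess_le order l₁ fun A hA => h4 A (by simp [hA])
        · exact expectedQueries_firstSuccess_le order l₂ fun A hA => h4 A (by simp [hA])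
    _ = ENNReal.ofReal (4 * l₁.length +
        outProb order (firstSuccess l₁) none * (4 * l₂.length)) := by
        rw [e, e, ← ENNReal.ofReal_mul (outProb_nonneg _ _ _), ENNReal.ofReal_add (by positivity)
          (mul_nonneg (outProb_nonneg _ _ _) (by positivity))]
    _ ≤ _ := by
        apply ENNReal.ofReal_le_ofReal
        have hJR : (J : ℝ) * 1 ≤ J * (n / Real.sqrt (2 * m * δ)) := by gcongr
        linarith

/-- Normalizing weights that are almost proportional to `d` gives a distribution that is close to
the normalization of `d`. -/
theorem abs_div_sum_sub_div_sum_le {ι : Type*} [Fintype ι] {Q d : ι → ℝ} {c δ : ℝ} (hδ : 0 ≤ δ)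
    (hδ' : δ ≤ 1 / 8) (hc : 0 < c) (hd : ∀ i, 0 ≤ d i) (hD : 0 < ∑ i, d i)
    (hlow : ∀ i, (1 - δ) * (c * d i) ≤ Q i) (hup : ∀ i, Q i ≤ (1 + δ) * (c * d i)) (i : ι) :
    |Q i / ∑ j, Q j - d i / ∑ j, d j| ≤ 8 * δ * (d i / ∑ j, d j) := by
  have h1 := Finset.sum_le_sum fun j (_ : j ∈ Finset.univ) => hlow j
  have h2 := Finset.sum_le_sum fun j (_ : j ∈ Finset.univ) => hup j
  rw [← Finset.mul_sum, ← Finset.mul_sum] at h1 h2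
  set D := ∑ j, d j
  set S := ∑ j, Q j
  have hcD : 0 < c * D := mul_pos hc hD
  have hS : 0 < S := lt_of_lt_of_le (mul_pos (by linarith) hcD) h1
  have hdi := hd i
  have hcd : 0 ≤ c * d i := mul_nonneg hc.le hdi
  rw [abs_le]
  constructor
  · have : (1 - 8 * δ) * (d i / D) ≤ Q i / S := by
      rw [le_div_iff₀ hS, mul_div_assoc', div_mul_eq_mul_div, div_le_iff₀ hD]
      -- The calculation rests on `(1 - 8δ)(1 + δ) ≤ 1 - δ`; the other case contradicts `δ ≤ 1/8`.
      by_cases h8 : 0 ≤ 1 - 8 * δ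
      · calc (1 - 8 * δ) * d i * S ≤ (1 - 8 * δ) * d i * ((1 + δ) * (c * D)) := by gcongr
          _ = ((1 - 8 * δ) * (1 + δ)) * (c * d i) * D := by ring
          _ ≤ (1 - δ) * (c * d i) * D := by
            gcongr
            nlinarith
          _ ≤ Q i * D := by
            gcongr
            exact hlow i
      · linarith
    linarith
  · have : Q i / S ≤ (1 + 8 * δ) * (d i / D) := by
      rw [div_le_iff₀ hS, mul_div_assoc', div_mul_eq_mul_div, le_div_iff₀ hD]
      calc Q i * D ≤ (1 + δ) * (c * d i) * D := by
            gcongr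
            exact hup i
        _ ≤ ((1 + 8 * δ) * (1 - δ)) * (c * d i) * D := by
            gcongr
            nlinarith
        _ = (1 + 8 * δ) * d i * ((1 - δ) * (c * D)) := by ring
        _ ≤ (1 + 8 * δ) * d i * S := by gcongr
    linarith

/-- The trials in `l₂` add at most `F d(w) ≤ δ c d(w)` to the probability of `w`, so the whole
schedule stays between `1 - δ` and `1 + δ` times `c d(w)`, and normalizing costs a constant factor.
-/
theorem outProb_trialSchedule_close {J : ℕ} {δ : ℝ} (hδ : 0 < δ) (hδ' : δ ≤ 1 / 8)
    (hm : 1 ≤ G.edgeFinset.card) (hJ : (Fintype.card V : ℝ) ≤ δ * 2 ^ J)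
    {l₁ l₂ : List (QueryAlg V (Option V))} (hl : trialSchedule V J = l₁ ++ l₂)
    (hl₁ : ∀ A ∈ l₁, ∃ c : ℝ, ∀ w, (1 - δ) * (c * G.degree w) ≤ outProb order A (some w) ∧
      outProb order A (some w) ≤ c * G.degree w)
    (hF : outProb order (firstSuccess l₁) none ≤ (((2 : ℝ) ^ J) ^ 4)⁻¹) (w : V) :
    |outProb order (firstSuccess (trialSchedule V J)) (some w) /
        ∑ x, outProb order (firstSuccess (trialSchedule V J)) (some x) -
      G.degree w / (2 * G.edgeFinset.card)| ≤
      8 * δ * (G.degree w / (2 * G.edgeFinset.card)) := by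
  obtain ⟨c, hc⟩ := exists_firstSuccess_proportional order (d := fun w => (G.degree w : ℝ)) l₁ hl₁
  set F := outProb order (firstSuccess l₁) none with hFdef
  have hF0 : 0 ≤ F := outProb_nonneg _ _ _
  have hsum := outProb_none_add_sum order (firstSuccess l₁)
  have hcm := Finset.sum_le_sum fun w (_ : w ∈ Finset.univ) => (hc w).2
  rw [← Finset.mul_sum, sum_degree_real] at hcm
  have hm1 : (1 : ℝ) ≤ G.edgeFinset.card := by exact_mod_cast hm
  have hmn := two_mul_card_edgeFinset_le_sq (G := G)
  -- Summing over `w` gives `1 - F ≤ 2mc`, so it suffices that `2m F ≤ δ (1 - F)`. This is `h1`,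
  -- where `F ≤ 2^(-4J)` and `2^J ≥ n/δ` enter.
  have hFδ : F ≤ δ * c := by
    set n : ℝ := (Fintype.card V : ℝ)
    set m : ℝ := (G.edgeFinset.card : ℝ)
    set X : ℝ := 2 ^ J
    have hX0 : 0 < X := by positivity
    have hn0 : 0 < n := Nat.cast_pos.2 Fintype.card_pos
    have hn1 : 1 ≤ n := by nlinarith
    have hnX : n ≤ X := hJ.trans (mul_le_of_le_one_left hX0.le (by linarith))
    have h1 : F * (2 * m + δ) ≤ δ := by
      calc F * (2 * m + δ) ≤ (X ^ 4)⁻¹ * (2 * m + δ) := by gcongr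
        _ ≤ δ := by
          rw [inv_mul_le_iff₀ (by positivity)]
          calc 2 * m + δ ≤ n ^ 2 * 2 := by nlinarith [one_le_pow₀ (n := 2) hn1]
            _ ≤ n * X ^ 3 := by
              have h5 : n ^ 2 ≤ X ^ 2 := by gcongr
              have h6 : 2 * n ≤ X ^ 3 := by
                calc 2 * n ≤ X := by nlinarith
                  _ ≤ X ^ 3 := le_self_pow₀ (by linarith) (by norm_num)
              nlinarith
            _ ≤ δ * X * X ^ 3 := by gcongr
            _ = X ^ 4 * δ := by ring
    have h2 : 1 - F ≤ c * (2 * m) := by linarith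
    have h3 := mul_le_mul_of_nonneg_left h2 hδ.le
    have h4 : F * (2 * m) ≤ δ * c * (2 * m) := by linarith
    exact le_of_mul_le_mul_right h4 (by linarith)
  have hc0 : 0 < c := by
    rcases hF0.eq_or_lt with h | h
    · by_contra! hc'
      nlinarith
    · exact (mul_pos_iff_of_pos_left hδ).1 (h.trans_le hFδ)
  have hQ : ∀ w, outProb order (firstSuccess (trialSchedule V J)) (some w) =
      outProb order (firstSuccess l₁) (some w) + F * outProb order (firstSuccess l₂) (some w) := by
    intro w
    rw [hl, outProb_firstSuccess_append_some]
  -- Bad thresholds may distort the law but never output an isolated vertex; elsewhere the trivial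
  -- bound `1 ≤ d(w)` suffices.
  have hQ₂ : ∀ w, outProb order (firstSuccess l₂) (some w) ≤ G.degree w := by
    intro w
    rcases Nat.eq_zero_or_pos (G.degree w) with h | h
    · rw [outProb_firstSuccess_eq_zero, h, Nat.cast_zero]
      intro A hA
      obtain ⟨k, rfl⟩ := exists_of_mem_trialSchedule (A := A) (J := J) (by simp [hl, hA])
      refine le_antisymm ?_ (outProb_nonneg _ _ _)
      simpa [h] using outProb_vertexTrial_le order k w
    · exact (outProb_le_one _ _ _).trans (by exact_mod_cast h)
  have := abs_div_sum_sub_div_sum_le (Q := fun w =>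
    outProb order (firstSuccess (trialSchedule V J)) (some w))
    (d := fun w => (G.degree w : ℝ)) hδ.le hδ' hc0 (fun w => Nat.cast_nonneg _)
    (by rw [sum_degree_real]; linarith) (fun w => ?_) (fun w => ?_) w
  · rwa [sum_degree_real] at this
  · simp only [hQ]
    linarith [(hc w).1, mul_nonneg hF0 (outProb_nonneg order (firstSuccess l₂) (some w))]
  · simp only [hQ]
    have h1 := mul_le_mul hFδ (hQ₂ w) (outProb_nonneg _ _ _) (by positivity)
    linarith [(hc w).2]

end Sampler

/-! ### Rounding, conditioning and the final constants. -/

open QueryAlg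

theorem le_two_pow_clog_ceil {x : ℝ} : x ≤ 2 ^ Nat.clog 2 ⌈x⌉₊ := by
  refine (Nat.le_ceil x).trans ?_
  exact_mod_cast Nat.le_pow_clog one_lt_two _

theorem two_pow_clog_ceil_le {x : ℝ} (hx : 1 < x) : (2 : ℝ) ^ Nat.clog 2 ⌈x⌉₊ ≤ 2 * x := by
  have h1 : 1 < ⌈x⌉₊ := Nat.lt_ceil.2 (by simpa using hx)
  have h2 := Nat.lt_ceil.1 (Nat.pow_pred_clog_lt_self one_lt_two h1)
  have h3 := Nat.clog_pos one_lt_two h1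
  obtain ⟨j, hj⟩ := Nat.exists_eq_succ_of_ne_zero h3.ne'
  rw [hj] at h2 ⊢
  simp only [Nat.succ_eq_add_one, Nat.pred_eq_sub_one, Nat.add_sub_cancel, Nat.cast_pow,
    Nat.cast_ofNat] at h2
  rw [Nat.succ_eq_add_one, pow_succ]
  linarith

/-- Taking logarithms, `J log 2 ≤ 4 log 2 + log y ≤ 5 log y`, and `log 2 > 1/2`. -/
theorem cast_le_ten_mul_log {J : ℕ} {y : ℝ} (hy : 2 ≤ y) (hJ : (2 : ℝ) ^ J ≤ 16 * y) :
    (J : ℝ) ≤ 10 * Real.log y := by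
  have hy0 : 0 < y := by linarith
  have h1 := Real.log_le_log (by positivity) hJ
  rw [Real.log_pow, Real.log_mul (by norm_num) hy0.ne',
    show (16 : ℝ) = 2 ^ 4 by norm_num, Real.log_pow] at h1
  have h2 := Real.log_le_log two_pos hy
  have h3 := Real.log_two_gt_d9
  push_cast at h1
  nlinarith [Nat.cast_nonneg (α := ℝ) J]

variable {V : Type u} [Fintype V] [Nonempty V] {G : SimpleGraph V} [DecidableRel G.Adj]
  (order : NeighborOrder G)

theorem successProb_eq_ofReal (A : QueryAlg V (Option V)) :
    A.successProb order = ENNReal.ofReal (∑ w, outProb order A (some w)) := by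
  rw [ENNReal.ofReal_sum_of_nonneg fun w _ => outProb_nonneg _ _ _]
  exact Finset.sum_congr rfl fun w _ => (ENNReal.ofReal_toReal (PMF.apply_ne_top _ _)).symm

/-- The law of the output of `A`, conditioned on a vertex being output. -/
noncomputable def conditionalLaw (A : QueryAlg V (Option V)) (h : A.successProb order ≠ 0) :
    PMF V :=
  PMF.ofFintype (fun w => A.outputLaw order (some w) / A.successProb order) (by
    simp only [div_eq_mul_inv]
    rw [← Finset.sum_mul]
    exact ENNReal.mul_inv_cancel h (ENNReal.sum_ne_top.2 fun _ _ => PMF.apply_ne_top _ _))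

theorem conditionalLaw_apply (A : QueryAlg V (Option V)) (h : A.successProb order ≠ 0) (w : V) :
    conditionalLaw order A h w = A.outputLaw order (some w) / A.successProb order := rfl

theorem outputLaw_some_eq_mul_conditionalLaw (A : QueryAlg V (Option V))
    (h : A.successProb order ≠ 0) (w : V) :
    A.outputLaw order (some w) = A.successProb order * conditionalLaw order A h w := by
  rw [conditionalLaw_apply, ENNReal.mul_div_cancel h (by simp [successProb_eq_ofReal])]

theorem toReal_conditionalLaw (A : QueryAlg V (Option V)) (h : A.successProb order ≠ 0) (w : V) :
    (conditionalLaw order A h w).toReal =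
      outProb order A (some w) / ∑ x, outProb order A (some x) := by
  rw [conditionalLaw_apply, ENNReal.toReal_div, successProb_eq_ofReal,
    ENNReal.toReal_ofReal (Finset.sum_nonneg fun w _ => outProb_nonneg _ _ _), outProb]

theorem two_thirds_le_successProb {l₁ l₂ : List (QueryAlg V (Option V))}
    (hF : outProb order (firstSuccess l₁) none ≤ 1 / 3) :
    2 / 3 ≤ (firstSuccess (l₁ ++ l₂)).successProb order := by
  have h1 := outProb_none_add_sum order (firstSuccess (l₁ ++ l₂))
  have h2 : outProb order (firstSuccess (l₁ ++ l₂)) none ≤ 1 / 3 := by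
    rw [outProb_firstSuccess_append_none]
    exact (mul_le_of_le_one_right (outProb_nonneg _ _ _) (outProb_le_one _ _ _)).trans hF
  rw [successProb_eq_ofReal, show (2 / 3 : ℝ≥0∞) = ENNReal.ofReal (2 / 3) by
    rw [ENNReal.ofReal_div_of_pos (by norm_num)]; simp]
  exact ENNReal.ofReal_le_ofReal (by linarith)

end QueryModel

theorem corollary4 :
    ∃ (A : (V : Type u) → [Fintype V] → [Nonempty V] → (ε : ℝ) → QueryAlg V (Option V))
      (C : ℝ) (k : ℕ),
      ∀ (V : Type u) [Fintype V] [Nonempty V] [DecidableEq V] (ε : ℝ), 0 < ε →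
      ∀ (G : SimpleGraph V) [DecidableRel G.Adj] (hm : 1 ≤ G.edgeFinset.card)
        (order : NeighborOrder G),
        2 / 3 ≤ (A V ε).successProb order ∧
        (∃ P : PMF V,
          (∀ w : V, (A V ε).outputLaw order (some w) = (A V ε).successProb order * P w) ∧
          PointwiseClose ε P (degreeDist G hm)) ∧
        (A V ε).expectedQueries order ≤
          ENNReal.ofReal
            (C * ((Fintype.card V : ℝ) / Real.sqrt (min ε 1 * (G.edgeFinset.card : ℝ))) *
              Real.log ((Fintype.card V : ℝ) / min ε 1) ^ k) := by
  -- `40960 = 2048 · 10 · 2`: the cost bound, `J ≤ 10 log (n / min ε 1)`, and `√(2mδ) = √(min ε 1 ·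
  -- m) / 2`.
  refine ⟨fun V _ _ ε => degreeSampler V ε, 40960, 1, ?_⟩
  intro V _ _ _ ε hε G _ hm order
  have hε' : 0 < min ε 1 := lt_min hε one_pos
  have hε1 : min ε 1 ≤ 1 := min_le_right _ _
  have hm1 : (1 : ℝ) ≤ G.edgeFinset.card := by exact_mod_cast hm
  have hmn := two_mul_card_edgeFinset_le_sq (G := G)
  have hn : (2 : ℝ) ≤ Fintype.card V := by
    have h : 1 < Fintype.card V := by
      by_contra! h
      have h' : (Fintype.card V : ℝ) ≤ 1 := by exact_mod_cast h
      have h0 : (0 : ℝ) ≤ Fintype.card V := Nat.cast_nonneg _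
      nlinarith
    exact_mod_cast h
  set δ : ℝ := min ε 1 / 8 with hδ_def
  have hδ : 0 < δ := by positivity
  have hδ' : δ ≤ 1 / 8 := by rw [hδ_def]; linarith
  have hx : 1 < (Fintype.card V : ℝ) / δ := by
    rw [one_lt_div hδ]
    linarith
  obtain ⟨J, hJ_def⟩ : ∃ J, J = Nat.clog 2 ⌈(Fintype.card V : ℝ) / δ⌉₊ := ⟨_, rfl⟩
  have hA : degreeSampler V ε = firstSuccess (trialSchedule V J) := by
    rw [degreeSampler, hJ_def]
  have hJ₁ : (Fintype.card V : ℝ) ≤ δ * 2 ^ J := by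
    rw [← div_le_iff₀' hδ, hJ_def]
    exact le_two_pow_clog_ceil
  have hJ₂ : (2 : ℝ) ^ J ≤ 2 * (Fintype.card V / δ) := hJ_def ▸ two_pow_clog_ceil_le hx
  have hJ₂' : δ * 2 ^ J ≤ 2 * Fintype.card V := by
    rw [← le_div_iff₀' hδ]
    linarith [mul_div_assoc 2 (Fintype.card V : ℝ) δ]
  obtain ⟨l₁, l₂, hl, hl₁, hF, hlen⟩ := exists_trialSchedule_eq_append order hδ hδ' hm hJ₁ hJ₂'
  have hF₃ : outProb order (firstSuccess l₁) none ≤ 1 / 3 := by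
    have hX : (3 : ℝ) ≤ 2 ^ J := by nlinarith [pow_pos (two_pos (α := ℝ)) J]
    refine hF.trans ?_
    rw [one_div]
    gcongr
    exact hX.trans (le_self_pow₀ (by linarith) (by norm_num))
  have hsucc : 2 / 3 ≤ (degreeSampler V ε).successProb order := by
    rw [hA, hl]
    exact two_thirds_le_successProb order hF₃
  have hne : (degreeSampler V ε).successProb order ≠ 0 := by
    intro h
    rw [h] at hsucc
    simp at hsucc
  refine ⟨hsucc, ⟨conditionalLaw order _ hne,
    outputLaw_some_eq_mul_conditionalLaw order _ hne, fun w => ?_⟩, ?_⟩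
  · have hd : (degreeDist G hm w).toReal = G.degree w / (2 * G.edgeFinset.card) := by
      simp [degreeDist]
    rw [hd, toReal_conditionalLaw, hA]
    refine (outProb_trialSchedule_close order hδ hδ' hm hJ₁ hl hl₁ hF w).trans ?_
    gcongr
    rw [hδ_def]
    linarith [min_le_left ε 1]
  · beta_reduce
    rw [hA]
    refine (expectedQueries_trialSchedule_le order hδ hδ' hm hl hF hlen).trans ?_
    apply ENNReal.ofReal_le_ofReal
    have hlog : (J : ℝ) ≤ 10 * Real.log (Fintype.card V / min ε 1) := by
      refine cast_le_ten_mul_log ?_ ?_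
      · rw [le_div_iff₀ hε']
        linarith
      · refine hJ₂.trans_eq ?_
        rw [hδ_def]
        field_simp
        norm_num
    have hsqrt : Real.sqrt (2 * G.edgeFinset.card * δ) =
        Real.sqrt (min ε 1 * G.edgeFinset.card) / 2 := by
      rw [show 2 * (G.edgeFinset.card : ℝ) * δ = min ε 1 * G.edgeFinset.card / 2 ^ 2 by
        rw [hδ_def]; ring, Real.sqrt_div' _ (by norm_num), Real.sqrt_sq two_pos.le]
    rw [hsqrt, pow_one]
    calc (2048 : ℝ) * J * (Fintype.card V / (Real.sqrt (min ε 1 * G.edgeFinset.card) / 2)) ≤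
          2048 * (10 * Real.log (Fintype.card V / min ε 1)) *
            (Fintype.card V / (Real.sqrt (min ε 1 * G.edgeFinset.card) / 2)) := by gcongr
      _ = _ := by
        rw [div_div_eq_mul_div]
        ring
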